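/- Let $1\le q,r<\infty$, $C,\sigma,\alpha,\gamma>0$ with $\gamma r>q$, put $\kappa=\gamma r/q>1$, and let $m_0\ge q\gamma^{-1}$ satisfy $$\delta:=(\kappa-1)\,m_0+q\big(\tfrac1\gamma-1\big)>0 .$$ Then there is a constant $K>0$, depending only on $q,r,C,\sigma,\alpha,\gamma,m_0$, with the following property. Let $(\Sigma,\mu)$ be a $\sigma$-finite measure space, let $\omega\ge 0$, $\beta>0$, and let $\{T_t\}_{t\ge 0}$ be a (nonlinear) semigroup of maps of $L^q\cap L^\infty(\Sigma,\mu)$ (real-valued functions) into itself, i.e. $T_{t+s}=T_t\circ T_s$ for all $t,s\ge0$. Suppose that for all $t>0$ and $u,\hat u\in L^q\cap L^\infty(\Sigma,\mu)$ $$\|T_tu-T_t\hat u\|_\infty\le e^{\omega t}\|u-\hat u\|_\infty,\qquad \|T_tu-T_t\hat u\|_r\le \big(\tfrac Cq\big)^{1/\sigma}t^{-\alpha}e^{\omega\beta t}\|u-\hat u\|_q^{\gamma}.$$ Then $L^q\cap L^\infty(\Sigma,\mu)\subseteq L^{\kappa m_0}(\Sigma,\mu)$ and for every $t>0$ the map $T_t$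 has a unique continuous extension $T_t:L^{\kappa m_0}(\Sigma,\mu)\to L^\infty(\Sigma,\mu)$. Put $$\alpha^*=\frac{\alpha q\gamma^{-1}}{\delta},\qquad \gamma^*=\frac{(\kappa-1)m_0}{\delta},\qquad N=(\beta-1)\kappa+\gamma-\beta .$$ (i) If $N\ge0$ or $\gamma^2r<q^2$ (in particular whenever $\beta=\gamma+1$), then with $\beta^*=\frac{N}{\delta}+1$, $$\|T_tu-T_t\hat u\|_\infty\le K\,t^{-\alpha^*}e^{\omega\beta^*t}\,\|u-\hat u\|_{\kappa m_0}^{\gamma^*}\qquad\text{for all } t>0,\ u,\hat u\in L^{\kappa m_0}(\Sigma,\mu).$$ (ii) Without the additional assumption of (i), the same estimate holds for all $t>0$ and $u,\hat u\in L^{\kappa m_0}(\Sigma,\mu)$ with $\beta^*$ replaced by $\frac{q}{\gamma(2\kappa-1)}\cdot\frac{N}{\delta}+1$. -/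

import Mathlib

open MeasureTheory Filter Topology
open scoped ENNReal NNReal

namespace NonlinearExtrapolation

variable {Ω : Type*} [MeasurableSpace Ω]

/-- The space `L^q ∩ L^∞` of classes of real-valued functions. -/
abbrev LqInf (q : ℝ) (μ : Measure Ω) : AddSubgroup (Ω →ₘ[μ] ℝ) :=
  Lp ℝ (ENNReal.ofReal q) μ ⊓ Lp ℝ ∞ μ

/-- The (nonlinear) semigroup property of a family of self-maps of `X`. Neither `T 0 = id` nor any
continuity in time is required. -/
def IsSemigroup {X : Type*} (T : ℝ≥0 → X → X) : Prop :=
  ∀ s t : ℝ≥0, T (t + s) = T t ∘ T s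

/-- Exponential growth in `L^∞` with rate `ω`:
`‖T_t u - T_t v‖_∞ ≤ e^{ω t} ‖u - v‖_∞` for `t > 0`. -/
def HasExpGrowthInf {q : ℝ} {μ : Measure Ω} (T : ℝ≥0 → LqInf q μ → LqInf q μ) (ω : ℝ) : Prop :=
  ∀ t : ℝ≥0, 0 < t → ∀ u v : LqInf q μ,
    eLpNorm ((T t u - T t v : LqInf q μ) : Ω →ₘ[μ] ℝ) ∞ μ ≤
      ENNReal.ofReal (Real.exp (ω * t)) * eLpNorm ((u - v : LqInf q μ) : Ω →ₘ[μ] ℝ) ∞ μ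

/-- The `L^q`-`L^r` estimate for differences:
`‖T_t u - T_t v‖_r ≤ M t^{-α} e^{ω β t} ‖u - v‖_q^γ` for `t > 0`
(the left-hand side being finite is part of the claim). -/
def HasLqLrEstimate {q : ℝ} {μ : Measure Ω} (T : ℝ≥0 → LqInf q μ → LqInf q μ)
    (r M α β γ ω : ℝ) : Prop :=
  ∀ t : ℝ≥0, 0 < t → ∀ u v : LqInf q μ,
    eLpNorm ((T t u - T t v : LqInf q μ) : Ω →ₘ[μ] ℝ) (ENNReal.ofReal r) μ ≤
      ENNReal.ofReal (M * (t : ℝ) ^ (-α) * Real.exp (ω * β * t)) *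
        eLpNorm ((u - v : LqInf q μ) : Ω →ₘ[μ] ℝ) (ENNReal.ofReal q) μ ^ γ

/-- `E : L^p → L^∞` is norm-continuous, and it extends the map `S` on `L^q ∩ L^∞`; this includes
that `L^q ∩ L^∞` is contained in `L^p`. -/
def IsContinuousExtension {q p : ℝ} {μ : Measure Ω} (S : LqInf q μ → LqInf q μ)
    (E : Lp ℝ (ENNReal.ofReal p) μ → Lp ℝ ∞ μ) : Prop :=
  (∀ (u : Lp ℝ (ENNReal.ofReal p) μ) (w : ℕ → Lp ℝ (ENNReal.ofReal p) μ),
    Tendsto (fun n => ‖w n - u‖) atTop (𝓝 0) →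
      Tendsto (fun n => ‖E (w n) - E u‖) atTop (𝓝 0)) ∧
  ∀ u : LqInf q μ, ∃ h : (u : Ω →ₘ[μ] ℝ) ∈ Lp ℝ (ENNReal.ofReal p) μ,
    (E ⟨(u : Ω →ₘ[μ] ℝ), h⟩ : Ω →ₘ[μ] ℝ) = (S u : Ω →ₘ[μ] ℝ)

/-- The common denominator `(γ r / q - 1) m₀ + q (1/γ - 1)`. -/
noncomputable def denom (q r γ m₀ : ℝ) : ℝ := (γ * r / q - 1) * m₀ + q * (1 / γ - 1)

noncomputable def alphaStar (q r α γ m₀ : ℝ) : ℝ := α * q * γ⁻¹ / denom q r γ m₀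

noncomputable def gammaStar (q r γ m₀ : ℝ) : ℝ := (γ * r / q - 1) * m₀ / denom q r γ m₀

/-- The numerator `(β - 1) γ r / q + γ - β`. -/
noncomputable def betaNum (q r β γ : ℝ) : ℝ := (β - 1) * (γ * r / q) + γ - β

noncomputable def betaStar (q r β γ m₀ : ℝ) : ℝ := betaNum q r β γ / denom q r γ m₀ + 1

/-- The variant of `betaStar` whose numerator carries the factor `(q/γ) / (2 γ r / q - 1)`. -/
noncomputable def betaStar' (q r β γ m₀ : ℝ) : ℝ :=
  q / γ / (2 * (γ * r / q) - 1) * betaNum q r β γ / denom q r γ m₀ + 1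

end NonlinearExtrapolation

/-! The proof is a De Giorgi type iteration on the excess `∫ (|f| - l)₊ ^ p` with `p = κ m₀`.
Truncating `u - v` at height `l` yields `w` between `u` and `v` with `|w - v| ≤ l`. The `L^∞` bound
controls `T_t w - T_t v` by `e^{ωt} l`, so only the excess of `u - v` over `l` enters the estimate
of `T_t u - T_t w`.

Truncating once more, at a height proportional to `z`, turns the `L^q`-`L^r` bound into a weak
`L^{p'}` bound with `p' = r + κ (p - q)` (`weak_type_estimate`). Since `p' - p = κ δ > 0`, a weak
`L^{p'}` function has finite `p`-excess over any positive level (`excess_le_of_weak`): raising the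
level improves the excess.

In `meas_lt_le_of_iterate` the time `t` is cut into geometrically shrinking pieces with ratio `x`.
The level increments halve, up to exponential growth factors, and the excess tends to zero, while
the accumulated level stays bounded. That level is the `L^∞` bound. Its constant is independent of
`ω` and `β`; its growth exponent depends on `x`, and the two forms of `β^*` come from different
choices of `x`. Density of `L^q ∩ L^∞` in `L^p` gives the extension. -/

namespace NonlinearExtrapolation

/-! ### Truncation, excess and weak-type bounds. -/

section Excess

variable {Ω : Type*} [MeasurableSpace Ω] {μ : Measure Ω}

/-- The integral `∫ (|f| - l)₊ ^ p`. -/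
noncomputable def excess (μ : Measure Ω) (l p : ℝ) (f : Ω → ℝ) : ℝ≥0∞ :=
  ∫⁻ x, ENNReal.ofReal (|f x| - l) ^ p ∂μ

/-- Truncating the difference of `u` and `v` at height `l` gives a point between `u` and `v`. -/
theorem exists_truncation {q : ℝ} (u v : LqInf q μ) {l : ℝ} (hl : 0 ≤ l) :
    ∃ w : LqInf q μ,
      (∀ᵐ x ∂μ, |((u - w : LqInf q μ) : Ω →ₘ[μ] ℝ) x| =
        max (|((u - v : LqInf q μ) : Ω →ₘ[μ] ℝ) x| - l) 0) ∧
      ∀ᵐ x ∂μ, |((w - v : LqInf q μ) : Ω →ₘ[μ] ℝ) x| ≤ l := by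
  have hc : Continuous fun x : ℝ => max (-l) (min l x) := by fun_prop
  set f : LqInf q μ := u - v with hf
  set h : Ω →ₘ[μ] ℝ := AEEqFun.comp _ hc (f : Ω →ₘ[μ] ℝ) with hh
  have hcoe : ∀ᵐ x ∂μ, h x = max (-l) (min l ((f : Ω →ₘ[μ] ℝ) x)) :=
    AEEqFun.coeFn_comp _ hc (f : Ω →ₘ[μ] ℝ)
  have hle : ∀ᵐ x ∂μ, ‖h x‖ ≤ ‖(f : Ω →ₘ[μ] ℝ) x‖ := by
    filter_upwards [hcoe] with x hx
    rw [hx, Real.norm_eq_abs, Real.norm_eq_abs]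
    generalize (f : Ω →ₘ[μ] ℝ) x = y
    rcases abs_cases y with ⟨h1, h2⟩ | ⟨h1, h2⟩ <;> rw [abs_le, h1] <;>
      constructor <;> simp <;> grind
  have hmem : h ∈ LqInf q μ :=
    ⟨Lp.mem_Lp_of_ae_le (g := ⟨_, f.2.1⟩) hle, Lp.mem_Lp_of_ae_le (g := ⟨_, f.2.2⟩) hle⟩
  -- Here `h` is `u - v` clipped to `[-l, l]`; moving `v` by `h` leaves the part of `u - v` beyond
  -- `l`.
  refine ⟨v + ⟨h, hmem⟩, ?_, ?_⟩
  · have e : u - (v + ⟨h, hmem⟩) = f - ⟨h, hmem⟩ := by rw [hf]; abel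
    rw [e]
    have := AEEqFun.coeFn_sub (f : Ω →ₘ[μ] ℝ) h
    filter_upwards [hcoe, this] with x hx h2
    have h3 : ((f - ⟨h, hmem⟩ : LqInf q μ) : Ω →ₘ[μ] ℝ) x = (f : Ω →ₘ[μ] ℝ) x - h x := h2
    rw [h3, hx]
    generalize (f : Ω →ₘ[μ] ℝ) x = y
    grind
  · have e : v + ⟨h, hmem⟩ - v = ⟨h, hmem⟩ := by abel
    rw [e]
    filter_upwards [hcoe] with x hx
    rw [hx, abs_le]
    generalize (f : Ω →ₘ[μ] ℝ) x = y
    grind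

theorem abs_sub_le_abs_sub_add {q : ℝ} (a b c : LqInf q μ) :
    ∀ᵐ x ∂μ, |((a - c : LqInf q μ) : Ω →ₘ[μ] ℝ) x| ≤
      |((a - b : LqInf q μ) : Ω →ₘ[μ] ℝ) x| + |((b - c : LqInf q μ) : Ω →ₘ[μ] ℝ) x| := by
  have h : ((a - c : LqInf q μ) : Ω →ₘ[μ] ℝ) =
      ((a - b : LqInf q μ) : Ω →ₘ[μ] ℝ) + ((b - c : LqInf q μ) : Ω →ₘ[μ] ℝ) := by
    rw [← AddSubgroup.coe_add]; congr 1; abel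
  rw [h]
  filter_upwards [AEEqFun.coeFn_add ((a - b : LqInf q μ) : Ω →ₘ[μ] ℝ)
    ((b - c : LqInf q μ) : Ω →ₘ[μ] ℝ)] with x hx
  rw [hx]
  exact abs_add_le _ _

theorem ae_abs_le_of_growth {q : ℝ} {S : LqInf q μ → LqInf q μ} {L l : ℝ} (hL : 0 ≤ L)
    (hS : ∀ u v : LqInf q μ, eLpNorm ((S u - S v : LqInf q μ) : Ω →ₘ[μ] ℝ) ∞ μ ≤
      ENNReal.ofReal L * eLpNorm ((u - v : LqInf q μ) : Ω →ₘ[μ] ℝ) ∞ μ)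
    (u v : LqInf q μ) (h : ∀ᵐ x ∂μ, |((u - v : LqInf q μ) : Ω →ₘ[μ] ℝ) x| ≤ l) (hl : 0 ≤ l) :
    ∀ᵐ x ∂μ, |((S u - S v : LqInf q μ) : Ω →ₘ[μ] ℝ) x| ≤ L * l := by
  have h1 : eLpNorm ((u - v : LqInf q μ) : Ω →ₘ[μ] ℝ) ∞ μ ≤ ENNReal.ofReal l := by
    rw [eLpNorm_exponent_top]
    exact eLpNormEssSup_le_of_ae_bound h
  have h2 := (hS u v).trans (mul_le_mul_right h1 _)
  rw [← ENNReal.ofReal_mul hL, eLpNorm_exponent_top] at h2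
  filter_upwards [enorm_ae_le_eLpNormEssSup (((S u - S v : LqInf q μ) : Ω →ₘ[μ] ℝ) : Ω → ℝ) μ]
    with x hx
  have h3 := hx.trans h2
  rw [← ofReal_norm, ENNReal.ofReal_le_ofReal_iff (by positivity)] at h3
  exact h3

/-- A map that is Lipschitz in `L^∞`, compared at `u` and `v` through the truncation `w`. -/
theorem exists_truncation_map {q : ℝ} {S : LqInf q μ → LqInf q μ} {L l : ℝ} (hL : 0 ≤ L)
    (hS : ∀ u v : LqInf q μ, eLpNorm ((S u - S v : LqInf q μ) : Ω →ₘ[μ] ℝ) ∞ μ ≤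
      ENNReal.ofReal L * eLpNorm ((u - v : LqInf q μ) : Ω →ₘ[μ] ℝ) ∞ μ)
    (u v : LqInf q μ) (hl : 0 ≤ l) :
    ∃ w : LqInf q μ,
      (∀ p, excess μ 0 p ((u - w : LqInf q μ) : Ω →ₘ[μ] ℝ) =
        excess μ l p ((u - v : LqInf q μ) : Ω →ₘ[μ] ℝ)) ∧
      ∀ᵐ x ∂μ, |((S u - S v : LqInf q μ) : Ω →ₘ[μ] ℝ) x| ≤
        |((S u - S w : LqInf q μ) : Ω →ₘ[μ] ℝ) x| + L * l := by
  obtain ⟨w, h1, h2⟩ := exists_truncation u v hl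
  refine ⟨w, fun p => lintegral_congr_ae ?_, ?_⟩
  · filter_upwards [h1] with x hx
    rw [hx, sub_zero, ENNReal.ofReal_max]
    simp
  · filter_upwards [abs_sub_le_abs_sub_add (S u) (S w) (S v), ae_abs_le_of_growth hL hS w v h2 hl]
      with x h3 h4
    linarith

theorem eLpNorm_eq_excess {p : ℝ} (hp : 0 < p) (f : Ω → ℝ) :
    eLpNorm f (ENNReal.ofReal p) μ = excess μ 0 p f ^ (1 / p) := by
  rw [eLpNorm_eq_lintegral_rpow_enorm_toReal (by simpa using hp) ENNReal.ofReal_ne_top,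
    ENNReal.toReal_ofReal hp.le]
  simp [excess, ← ofReal_norm]

theorem excess_zero_eq {p : ℝ} (hp : 0 < p) (f : Ω → ℝ) :
    excess μ 0 p f = eLpNorm f (ENNReal.ofReal p) μ ^ p := by
  rw [eLpNorm_eq_excess hp, ← ENNReal.rpow_mul, one_div_mul_cancel hp.ne', ENNReal.rpow_one]

/-- Chebyshev's inequality in terms of the excess. -/
theorem meas_lt_abs_le {p z : ℝ} (hp : 0 < p) (hz : 0 < z) {f : Ω → ℝ}
    (hf : AEStronglyMeasurable f μ) :
    μ {x | z < |f x|} ≤ ENNReal.ofReal (z ^ (-p)) * excess μ 0 p f := by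
  have hm : AEMeasurable (fun x => ENNReal.ofReal (|f x| - 0) ^ p) μ := by
    have := hf.aemeasurable
    fun_prop
  have h := mul_meas_ge_le_lintegral₀ hm (ENNReal.ofReal (z ^ p))
  have h1 : μ {x | z < |f x|} ≤
      μ {x | ENNReal.ofReal (z ^ p) ≤ ENNReal.ofReal (|f x| - 0) ^ p} := by
    refine measure_mono fun x (hx : z < |f x|) => ?_
    change ENNReal.ofReal (z ^ p) ≤ ENNReal.ofReal (|f x| - 0) ^ p
    rw [← ENNReal.ofReal_rpow_of_pos hz]
    exact ENNReal.rpow_le_rpow (ENNReal.ofReal_le_ofReal (by linarith)) hp.le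
  calc μ {x | z < |f x|}
      = ENNReal.ofReal (z ^ (-p)) * (ENNReal.ofReal (z ^ p) * μ {x | z < |f x|}) := by
        rw [← mul_assoc, ← ENNReal.ofReal_mul (by positivity), ← Real.rpow_add hz]
        simp
    _ ≤ _ := by gcongr; exact (mul_le_mul_right h1 _).trans h

/-- Lowering the exponent above a positive level. -/
theorem excess_le_mul_excess_zero {q p l : ℝ} (hq : 0 < q) (hqp : q ≤ p) (hl : 0 < l)
    (f : Ω → ℝ) :
    excess μ l q f ≤ ENNReal.ofReal (l ^ (-(p - q))) * excess μ 0 p f := by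
  rw [excess, excess, ← lintegral_const_mul' _ _ ENNReal.ofReal_ne_top]
  refine lintegral_mono fun x => ?_
  change ENNReal.ofReal (|f x| - l) ^ q ≤
    ENNReal.ofReal (l ^ (-(p - q))) * ENNReal.ofReal (|f x| - 0) ^ p
  rcases le_or_gt (|f x|) l with h | h
  · rw [ENNReal.ofReal_of_nonpos (by linarith), ENNReal.zero_rpow_of_pos hq]
    exact zero_le
  · have hy : 0 < |f x| := hl.trans h
    rw [sub_zero, ENNReal.ofReal_rpow_of_pos (by linarith), ENNReal.ofReal_rpow_of_pos hy,
      ← ENNReal.ofReal_mul (by positivity)]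
    apply ENNReal.ofReal_le_ofReal
    calc (|f x| - l) ^ q ≤ |f x| ^ q := Real.rpow_le_rpow (by linarith) (by linarith) hq.le
      _ = |f x| ^ (-(p - q)) * |f x| ^ p := by rw [← Real.rpow_add hy]; ring_nf
      _ ≤ l ^ (-(p - q)) * |f x| ^ p := by
        gcongr ?_ * _
        exact Real.rpow_le_rpow_of_nonpos hl h.le (by linarith)

/-- The weak-type estimate obtained from the two strong-type estimates of `S` by truncation. -/
theorem weak_type_estimate {q r γ p κ L M : ℝ} (hq : 0 < q) (hr : 0 < r) (hL : 0 < L)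
    (hM : 0 ≤ M) (hqp : q ≤ p) (hκ : κ = γ * r / q) (hκ0 : 0 ≤ κ)
    {S : LqInf q μ → LqInf q μ}
    (hS : ∀ u v : LqInf q μ, eLpNorm ((S u - S v : LqInf q μ) : Ω →ₘ[μ] ℝ) ∞ μ ≤
      ENNReal.ofReal L * eLpNorm ((u - v : LqInf q μ) : Ω →ₘ[μ] ℝ) ∞ μ)
    (hS' : ∀ u v : LqInf q μ,
      eLpNorm ((S u - S v : LqInf q μ) : Ω →ₘ[μ] ℝ) (ENNReal.ofReal r) μ ≤
      ENNReal.ofReal M * eLpNorm ((u - v : LqInf q μ) : Ω →ₘ[μ] ℝ) (ENNReal.ofReal q) μ ^ γ)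
    (u v : LqInf q μ) {z : ℝ} (hz : 0 < z) :
    μ {x | z < |((S u - S v : LqInf q μ) : Ω →ₘ[μ] ℝ) x|} ≤
      ENNReal.ofReal (2 ^ (r + κ * (p - q)) * M ^ r * L ^ (κ * (p - q)) *
        z ^ (-(r + κ * (p - q)))) *
        excess μ 0 p ((u - v : LqInf q μ) : Ω →ₘ[μ] ℝ) ^ κ := by
  -- At this height the bounded part contributes at most `L * (z / (2 * L)) = z / 2`, so the other
  -- part must exceed `z / 2`.
  obtain ⟨w, hw, hle⟩ := exists_truncation_map hL.le hS u v (l := z / (2 * L)) (by positivity)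
  have h1 : μ {x | z < |((S u - S v : LqInf q μ) : Ω →ₘ[μ] ℝ) x|} ≤
      μ {x | z / 2 < |((S u - S w : LqInf q μ) : Ω →ₘ[μ] ℝ) x|} := by
    refine measure_mono_ae ?_
    filter_upwards [hle] with x hx (h2 : z < _)
    change z / 2 < _
    have : L * (z / (2 * L)) = z / 2 := by field_simp
    linarith
  have h2 : excess μ 0 r ((S u - S w : LqInf q μ) : Ω →ₘ[μ] ℝ) ≤
      ENNReal.ofReal (M ^ r) * excess μ (z / (2 * L)) q ((u - v : LqInf q μ) : Ω →ₘ[μ] ℝ) ^ κ := by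
    rw [excess_zero_eq hr, ← hw q]
    refine (ENNReal.rpow_le_rpow (hS' u w) hr.le).trans ?_
    rw [eLpNorm_eq_excess hq, ENNReal.mul_rpow_of_nonneg _ _ hr.le,
      ENNReal.ofReal_rpow_of_nonneg hM hr.le, ← ENNReal.rpow_mul, ← ENNReal.rpow_mul]
    rw [show 1 / q * (γ * r) = κ by rw [hκ]; ring]
  refine h1.trans ((meas_lt_abs_le hr (half_pos hz) (AEEqFun.aestronglyMeasurable _)).trans ?_)
  calc _ ≤ ENNReal.ofReal ((z / 2) ^ (-r)) * (ENNReal.ofReal (M ^ r) *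
        (ENNReal.ofReal ((z / (2 * L)) ^ (-(p - q))) *
          excess μ 0 p ((u - v : LqInf q μ) : Ω →ₘ[μ] ℝ)) ^ κ) := by
        gcongr
        refine h2.trans ?_
        gcongr
        exact excess_le_mul_excess_zero hq hqp (by positivity) _
    _ = _ := by
        rw [ENNReal.mul_rpow_of_nonneg _ _ hκ0, ENNReal.ofReal_rpow_of_nonneg (by positivity) hκ0,
          ← mul_assoc, ← mul_assoc, ← ENNReal.ofReal_mul (by positivity),
          ← ENNReal.ofReal_mul (by positivity)]
        congr 2
        rw [← Real.rpow_mul (by positivity), Real.div_rpow hz.le zero_le_two,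
          Real.div_rpow hz.le (by positivity), Real.mul_rpow zero_le_two hL.le,
          neg_add, Real.rpow_add hz, Real.rpow_add zero_lt_two, Real.rpow_neg zero_le_two,
          show -(p - q) * κ = -(κ * (p - q)) by ring, Real.rpow_neg zero_le_two (κ * (p - q)),
          Real.rpow_neg hL.le]
        field_simp

/-- A weak-type bound with exponent `p'` controls the excess with any exponent `p < p'`. -/
theorem excess_le_of_weak {p p' η W : ℝ} (hp : 0 < p) (hpp : p < p') (hη : 0 < η) (hW : 0 ≤ W)
    {h : Ω → ℝ} (hm : AEStronglyMeasurable h μ)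
    (hw : ∀ z : ℝ, 0 < z → μ {x | z < |h x|} ≤ ENNReal.ofReal (W * z ^ (-p'))) :
    excess μ η p h ≤
      ENNReal.ofReal (2 ^ p * (1 - 2 ^ (-(p' - p)))⁻¹ * W * η ^ (-(p' - p))) := by
  -- Dyadic decomposition above `η`: on the layer `2 ^ j * η < |h| ≤ 2 ^ (j + 1) * η` the integrand
  -- is at most `c j`, and the weak bound controls the measure of `A j`.
  set A : ℕ → Set Ω := fun j => {x | 2 ^ j * η < |h x|} with hA
  have hAm : ∀ j, NullMeasurableSet (A j) μ := fun j =>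
    nullMeasurableSet_lt aemeasurable_const (by have := hm.aemeasurable; fun_prop)
  set c : ℕ → ℝ := fun j => (2 ^ (j + 1) * η) ^ p with hcdef
  have hpt : ∀ x, ENNReal.ofReal (|h x| - η) ^ p ≤
      ∑' j, (A j).indicator (fun _ => ENNReal.ofReal (c j)) x := by
    intro x
    rcases le_or_gt (|h x|) η with hx | hx
    · rw [ENNReal.ofReal_of_nonpos (by linarith), ENNReal.zero_rpow_of_pos hp]
      exact zero_le
    · obtain ⟨j, hj1, hj2⟩ := exists_nat_pow_near (x := |h x| / η) (y := 2)
        (by rw [le_div_iff₀ hη]; linarith) one_lt_two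
      rw [le_div_iff₀ hη] at hj1
      rw [div_lt_iff₀ hη] at hj2
      rcases hj1.lt_or_eq with hj1 | hj1
      · refine le_trans ?_ (ENNReal.le_tsum j)
        rw [Set.indicator_of_mem (show x ∈ A j from hj1),
          ENNReal.ofReal_rpow_of_pos (by linarith)]
        exact ENNReal.ofReal_le_ofReal
          (Real.rpow_le_rpow (by linarith) (by linarith) hp.le)
      -- At a dyadic value `|h x| = 2 ^ j * η` the strict inequality defining `A j` fails, so the
      -- point is charged to the layer below; `j = 0` is excluded by `η < |h x|`.
      · obtain _ | j := j
        · simp at hj1; linarith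
        refine le_trans ?_ (ENNReal.le_tsum j)
        rw [Set.indicator_of_mem (show x ∈ A j by
            change 2 ^ j * η < |h x|
            rw [← hj1, pow_succ]
            have : 0 < 2 ^ j * η := by positivity
            linarith),
          ENNReal.ofReal_rpow_of_pos (by linarith)]
        exact ENNReal.ofReal_le_ofReal
          (Real.rpow_le_rpow (by linarith) (by linarith) hp.le)
  -- The common ratio of the layer bounds; it is below one exactly because `p < p'`.
  set ϱ : ℝ := 2 ^ (-(p' - p)) with hϱ
  have hϱ0 : 0 ≤ ϱ := by positivity
  have hϱ1 : ϱ < 1 := Real.rpow_lt_one_of_one_lt_of_neg one_lt_two (by linarith)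
  have hterm : ∀ j, ENNReal.ofReal (c j) * μ (A j) ≤
      ENNReal.ofReal (2 ^ p * W * η ^ (-(p' - p)) * ϱ ^ j) := by
    intro j
    refine (mul_le_mul_right (hw (2 ^ j * η) (by positivity)) _).trans ?_
    rw [← ENNReal.ofReal_mul (by positivity)]
    apply le_of_eq
    congr 1
    have e1 : ((2:ℝ) ^ j) = 2 ^ (j : ℝ) := (Real.rpow_natCast 2 j).symm
    have e2 : ϱ ^ j = 2 ^ ((j : ℝ) * (-(p' - p))) := by
      rw [hϱ, ← Real.rpow_natCast, ← Real.rpow_mul zero_le_two, mul_comm]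
    rw [e2]
    simp only [hcdef, pow_succ]
    rw [Real.mul_rpow (by positivity) hη.le, Real.mul_rpow (by positivity) zero_le_two,
      Real.mul_rpow (by positivity) hη.le, e1, ← Real.rpow_mul zero_le_two,
      ← Real.rpow_mul zero_le_two, show -(p' - p) = p + -p' by ring, Real.rpow_add hη, mul_add,
      Real.rpow_add zero_lt_two]
    ring
  calc excess μ η p h ≤ ∫⁻ x, ∑' j, (A j).indicator (fun _ => ENNReal.ofReal (c j)) x ∂μ :=
        lintegral_mono hpt
    _ = ∑' j, ENNReal.ofReal (c j) * μ (A j) := by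
        rw [lintegral_tsum fun j => (aemeasurable_const.indicator₀ (hAm j))]
        congr 1
        ext j
        rw [lintegral_indicator_const₀ (hAm j)]
    _ ≤ ∑' j, ENNReal.ofReal (2 ^ p * W * η ^ (-(p' - p)) * ϱ ^ j) :=
        ENNReal.tsum_le_tsum hterm
    _ = _ := by
        rw [← ENNReal.ofReal_tsum_of_nonneg (fun j => by positivity)
          ((summable_geometric_of_lt_one hϱ0 hϱ1).mul_left _), tsum_mul_left,
          tsum_geometric_of_lt_one hϱ0 hϱ1]
        congr 1
        ring

end Excess

end NonlinearExtrapolation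

namespace NonlinearExtrapolation

/-! ### One-step estimates and their iteration in time. -/

section Iteration

variable {Ω : Type*} [MeasurableSpace Ω] {μ : Measure Ω}

/-- `T` maps into weak `L^p'`, above the transported level `e^{ω t} l`, with a constant given by the
excess over the level `l` of the initial difference. -/
def HasWeakEstimate {q : ℝ} (T : ℝ≥0 → LqInf q μ → LqInf q μ) (ω p p' κ ν ζ c : ℝ) : Prop :=
  ∀ t : ℝ≥0, 0 < t → ∀ (u v : LqInf q μ) (l ε z : ℝ), 0 ≤ l → 0 < z →
    excess μ l p ((u - v : LqInf q μ) : Ω →ₘ[μ] ℝ) ≤ ENNReal.ofReal (Real.exp ε) →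
    μ {x | z + Real.exp (ω * t) * l < |((T t u - T t v : LqInf q μ) : Ω →ₘ[μ] ℝ) x|} ≤
      ENNReal.ofReal (Real.exp (c - ν * Real.log t + ω * t * ζ + κ * ε) * z ^ (-p'))

/-- `T` improves the excess when the transported level is raised. -/
def HasExcessEstimate {q : ℝ} (T : ℝ≥0 → LqInf q μ → LqInf q μ) (ω p Δ κ ν ζ c : ℝ) : Prop :=
  ∀ t : ℝ≥0, 0 < t → ∀ (u v : LqInf q μ) (l ε h : ℝ), 0 ≤ l →
    excess μ l p ((u - v : LqInf q μ) : Ω →ₘ[μ] ℝ) ≤ ENNReal.ofReal (Real.exp ε) →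
    excess μ (Real.exp (ω * t) * (l + Real.exp h)) p
        ((T t u - T t v : LqInf q μ) : Ω →ₘ[μ] ℝ) ≤
      ENNReal.ofReal
        (Real.exp (c - ν * Real.log t + ω * t * ζ - Δ * (ω * t + h) + κ * ε))

section Estimates

variable {q r γ p κ ω M α β : ℝ}

/-- With every constant written as an exponential, the recursion of the iteration becomes linear in
the exponents. -/
theorem weak_constant_eq (hM : 0 < M) {t : ℝ} (ht : 0 < t) (s : ℝ) :
    2 ^ (r + s) * (M * t ^ (-α) * Real.exp (ω * β * t)) ^ r * Real.exp (ω * t) ^ s =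
      Real.exp (Real.log (2 ^ (r + s) * M ^ r) - α * r * Real.log t + ω * t * (r * β + s)) := by
  rw [Real.exp_add, Real.exp_sub, Real.exp_log (by positivity), Real.mul_rpow (by positivity)
    (by positivity), Real.mul_rpow hM.le (by positivity), ← Real.rpow_mul ht.le,
    Real.rpow_def_of_pos ht, ← Real.exp_mul, ← Real.exp_mul, div_eq_mul_inv, ← Real.exp_neg,
    show ω * t * (r * β + s) = ω * β * t * r + ω * t * s by ring, Real.exp_add,
    show Real.log t * (-α * r) = -(α * r * Real.log t) by ring]
  ring

/-- Two truncations are at work: the one at `l` replaces `v` by `w` and costs `e^{ωt} l`, and the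
`z`-dependent one inside `weak_type_estimate` is applied to `u` and `w`, whose zero-level excess is
the excess of `u - v` over `l`. Both one-step estimates follow from this. -/
theorem weak_aux {T : ℝ≥0 → LqInf q μ → LqInf q μ} (hq : 0 < q) (hr : 0 < r) (hM : 0 < M)
    (hqp : q ≤ p) (hκ : κ = γ * r / q) (hκ0 : 0 ≤ κ)
    (hT : HasExpGrowthInf T ω) (hT' : HasLqLrEstimate T r M α β γ ω)
    (t : ℝ≥0) (ht : 0 < t) (u v : LqInf q μ) (l ε : ℝ) (hl : 0 ≤ l)
    (he : excess μ l p ((u - v : LqInf q μ) : Ω →ₘ[μ] ℝ) ≤ ENNReal.ofReal (Real.exp ε)) :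
    ∃ w : LqInf q μ,
      (∀ᵐ x ∂μ, |((T t u - T t v : LqInf q μ) : Ω →ₘ[μ] ℝ) x| ≤
        |((T t u - T t w : LqInf q μ) : Ω →ₘ[μ] ℝ) x| + Real.exp (ω * t) * l) ∧
      ∀ z : ℝ, 0 < z → μ {x | z < |((T t u - T t w : LqInf q μ) : Ω →ₘ[μ] ℝ) x|} ≤
        ENNReal.ofReal (Real.exp (Real.log (2 ^ (r + κ * (p - q)) * M ^ r) - α * r * Real.log t +
          ω * t * (r * β + κ * (p - q)) + κ * ε) * z ^ (-(r + κ * (p - q)))) := by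
  have ht' : (0 : ℝ) < t := ht
  obtain ⟨w, hw, hle⟩ := exists_truncation_map (Real.exp_pos (ω * t)).le (hT t ht) u v hl
  refine ⟨w, hle, fun z hz => ?_⟩
  refine (weak_type_estimate hq hr (Real.exp_pos (ω * t)) (by positivity) hqp hκ hκ0 (hT t ht)
    (hT' t ht) u w hz).trans ?_
  rw [hw p, weak_constant_eq hM ht', Real.exp_add (_ + _) (κ * ε),
    mul_right_comm (Real.exp _) (Real.exp (κ * ε)),
    ENNReal.ofReal_mul (q := Real.exp (κ * ε)) (by positivity)]
  gcongr
  refine (ENNReal.rpow_le_rpow he hκ0).trans ?_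
  rw [ENNReal.ofReal_rpow_of_nonneg (Real.exp_pos _).le hκ0, ← Real.exp_mul, mul_comm]

theorem hasWeakEstimate {T : ℝ≥0 → LqInf q μ → LqInf q μ} (hq : 0 < q) (hr : 0 < r) (hM : 0 < M)
    (hqp : q ≤ p) (hκ : κ = γ * r / q) (hκ0 : 0 ≤ κ)
    (hT : HasExpGrowthInf T ω) (hT' : HasLqLrEstimate T r M α β γ ω) :
    HasWeakEstimate T ω p (r + κ * (p - q)) κ (α * r) (r * β + κ * (p - q))
      (Real.log (2 ^ (r + κ * (p - q)) * M ^ r)) := by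
  intro t ht u v l ε z hl hz he
  obtain ⟨w, hle, hw⟩ := weak_aux hq hr hM hqp hκ hκ0 hT hT' t ht u v l ε hl he
  refine (measure_mono_ae ?_).trans (hw z hz)
  filter_upwards [hle] with x hx (h2 : z + _ < _)
  change z < _
  linarith

theorem hasExcessEstimate {T : ℝ≥0 → LqInf q μ → LqInf q μ} (hq : 0 < q) (hr : 0 < r)
    (hM : 0 < M) (hqp : q ≤ p) (hκ : κ = γ * r / q) (hκ0 : 0 ≤ κ)
    (hp : p < r + κ * (p - q))
    (hT : HasExpGrowthInf T ω) (hT' : HasLqLrEstimate T r M α β γ ω) :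
    HasExcessEstimate T ω p (r + κ * (p - q) - p) κ (α * r) (r * β + κ * (p - q))
      (Real.log (2 ^ p * (1 - 2 ^ (-(r + κ * (p - q) - p)))⁻¹) +
        Real.log (2 ^ (r + κ * (p - q)) * M ^ r)) := by
  intro t ht u v l ε h hl he
  obtain ⟨w, hle, hw⟩ := weak_aux hq hr hM hqp hκ hκ0 hT hT' t ht u v l ε hl he
  have h1 : (2 : ℝ) ^ (-(r + κ * (p - q) - p)) < 1 :=
    Real.rpow_lt_one_of_one_lt_of_neg one_lt_two (by linarith)
  have h2 : 0 < (1 - (2 : ℝ) ^ (-(r + κ * (p - q) - p)))⁻¹ := inv_pos.2 (by linarith)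
  have hp0 : 0 < p := hq.trans_le hqp
  have key := excess_le_of_weak hp0 hp (by positivity : 0 < Real.exp (ω * t) * Real.exp h)
    (Real.exp_pos _).le (AEEqFun.aestronglyMeasurable _) hw
  have mono : excess μ (Real.exp (ω * t) * (l + Real.exp h)) p
        ((T t u - T t v : LqInf q μ) : Ω →ₘ[μ] ℝ) ≤
      excess μ (Real.exp (ω * t) * Real.exp h) p
        ((T t u - T t w : LqInf q μ) : Ω →ₘ[μ] ℝ) := by
    refine lintegral_mono_ae ?_
    filter_upwards [hle] with x hx
    refine ENNReal.rpow_le_rpow (ENNReal.ofReal_le_ofReal ?_) hp0.le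
    linarith
  refine mono.trans (key.trans (le_of_eq ?_))
  congr 1
  rw [← Real.exp_add, ← Real.exp_mul]
  nth_rw 1 [← Real.exp_log (show 0 < (2 : ℝ) ^ p * (1 - 2 ^ (-(r + κ * (p - q) - p)))⁻¹ by
    positivity)]
  rw [← Real.exp_add, ← Real.exp_add]
  congr 1
  ring

end Estimates

/-- The iteration over the time steps `(1 - x) t, x (1 - x) t, x² (1 - x) t, …`. -/
theorem meas_lt_le_of_iterate {q p p' κ Δ ω ν ζ c c' a x b k αs : ℝ}
    {T : ℝ≥0 → LqInf q μ → LqInf q μ} (hsg : IsSemigroup T)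
    (hW : HasWeakEstimate T ω p p' κ ν ζ c) (hE : HasExcessEstimate T ω p Δ κ ν ζ c')
    (hω : 0 ≤ ω) (hκ : 1 < κ) (ha : 0 < a) (haΔ : a * Δ = κ - 1) (hν : 0 < ν) (hζ : 0 ≤ ζ)
    (hx0 : 0 < x) (hx1 : x < 1) (hαs : αs * (κ - 1) = a * ν)
    (hb : b * (κ - x) = (1 - x) * (a * ζ - κ))
    (hk : (κ - 1) * k =
      -αs * Real.log x + a * c' - αs * (κ - 1) * Real.log (1 - x) + κ * Real.log 2)
    (n : ℕ) : ∀ t : ℝ≥0, 0 < t → ∀ (u v : LqInf q μ) (l ε z : ℝ), 0 ≤ l → 0 < z →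
    excess μ l p ((u - v : LqInf q μ) : Ω →ₘ[μ] ℝ) ≤ ENNReal.ofReal (Real.exp ε) →
    μ {y | z + Real.exp (ω * t) * (l + Real.exp (k - αs * Real.log t + ω * b * t + a * ε)) <
        |((T t u - T t v : LqInf q μ) : Ω →ₘ[μ] ℝ) y|} ≤
      ENNReal.ofReal (Real.exp (-(n * (κ / a * Real.log 2)) + |1 + b| * (κ / a) * (ω * t) +
        (c - ν * Real.log t + ω * t * ζ) + κ * ε) * z ^ (-p')) := by
  -- The relation `a * Δ = κ - 1` makes an increment proportional to `excess ^ a` scale invariant.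
  -- The equations for `αs`, `b` and `k` match the coefficients of `log t`, of `ω t` and of `1`, so
  -- that the claim reproduces itself from time `x t` to time `t`.
  have hκa : 0 < κ / a := by positivity
  induction n with
  | zero =>
    intro t ht u v l ε z hl hz he
    refine (measure_mono fun y hy => ?_).trans ((hW t ht u v l ε z hl hz he).trans ?_)
    · rw [Set.mem_ofPred_eq] at hy ⊢
      refine lt_of_le_of_lt ?_ hy
      have := (Real.exp_pos (k - αs * Real.log t + ω * b * t + a * ε)).le
      gcongr
      linarith
    · apply ENNReal.ofReal_le_ofReal
      refine mul_le_mul_of_nonneg_right (Real.exp_le_exp.2 ?_) (by positivity)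
      have : 0 ≤ |1 + b| * (κ / a) * (ω * t) := by positivity
      simp only [Nat.cast_zero]
      linarith
  | succ n ih =>
    intro t ht u v l ε z hl hz he
    have ht' : (0 : ℝ) < t := ht
    set X : ℝ≥0 := ⟨x, hx0.le⟩ with hX
    set Y : ℝ≥0 := ⟨1 - x, by linarith⟩ with hY
    have hX0 : 0 < X := hx0
    have hY0 : 0 < Y := by change (0 : ℝ) < 1 - x; linarith
    have hXt : ((X * t : ℝ≥0) : ℝ) = x * t := rfl
    have hYt : ((Y * t : ℝ≥0) : ℝ) = (1 - x) * t := rfl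
    have hXY : X * t + Y * t = t := by
      rw [← add_mul]
      have : X + Y = 1 := by
        ext
        change x + (1 - x) = 1
        ring
      rw [this, one_mul]
    have hTt : ∀ w, T t w = T (X * t) (T (Y * t) w) := by
      intro w
      have := congrFun (hsg (Y * t) (X * t)) w
      rwa [hXY] at this
    have hlx : Real.log (x * t) = Real.log x + Real.log t := Real.log_mul hx0.ne' ht'.ne'
    have hly : Real.log ((1 - x) * t) = Real.log (1 - x) + Real.log t :=
      Real.log_mul (by linarith) ht'.ne'
    have hlx0 : Real.log x ≤ 0 := Real.log_nonpos hx0.le hx1.le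
    set g : ℝ := k - αs * Real.log t + ω * b * t + a * ε with hg
    -- The first time step spends half of the available increment `e^g`; the other half is left for
    -- the remaining time `x t`.
    have h1 := hE (Y * t) (mul_pos hY0 ht) u v l ε (g - Real.log 2) hl he
    rw [hYt, hly] at h1
    have h2 := ih (X * t) (mul_pos hX0 ht) (T (Y * t) u) (T (Y * t) v) _ _ z
      (by positivity) hz h1
    rw [← hTt, ← hTt, hXt, hlx] at h2
    set ε' : ℝ := c' - ν * (Real.log (1 - x) + Real.log t) + ω * ((1 - x) * t) * ζ -
      Δ * (ω * ((1 - x) * t) + (g - Real.log 2)) + κ * ε with hε'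
    -- Apart from growth factors, the power `a` of the excess shrinks by `x ^ αs / 2`.
    have hgain : a * ε' = ω * ((1 - x) * t) - Real.log 2 + αs * Real.log x +
        ω * b * ((1 - x) * t) + a * ε := by
      rw [hε', hg]
      linear_combination (ω * ((1 - x) * t) +
        (k - αs * Real.log t + ω * b * t + a * ε - Real.log 2)) * (-haΔ) - hk +
        (Real.log (1 - x) + Real.log t) * hαs - ω * t * hb
    have hrec : k - αs * (Real.log x + Real.log t) + ω * b * (x * t) + a * ε' =
        g + ω * ((1 - x) * t) - Real.log 2 := by
      rw [hgain, hg]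
      ring
    clear_value ε' g
    -- By `hrec` the increment needed from time `(1 - x) t` on is the other half of `e^g`,
    -- transported by the growth factor, so the levels add up exactly.
    have hlevel : Real.exp (ω * (x * t)) * (Real.exp (ω * ((1 - x) * t)) *
        (l + Real.exp (g - Real.log 2)) + Real.exp (k - αs * (Real.log x + Real.log t) +
          ω * b * (x * t) + a * ε')) = Real.exp (ω * t) * (l + Real.exp g) := by
      have e1 : Real.exp (g + ω * ((1 - x) * t) - Real.log 2) =
          Real.exp (ω * ((1 - x) * t)) * (Real.exp g / 2) := by
        rw [Real.exp_sub, Real.exp_add, Real.exp_log two_pos]; ring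
      have e2 : Real.exp (g - Real.log 2) = Real.exp g / 2 := by
        rw [Real.exp_sub, Real.exp_log two_pos]
      have e3 : Real.exp (ω * t) = Real.exp (ω * (x * t)) * Real.exp (ω * ((1 - x) * t)) := by
        rw [← Real.exp_add]
        ring_nf
      rw [hrec, e1, e2, e3]
      ring
    rw [hlevel] at h2
    refine h2.trans (ENNReal.ofReal_le_ofReal
      (mul_le_mul_of_nonneg_right (Real.exp_le_exp.2 ?_) (by positivity)))
    have hε'' : κ * ε' = κ / a * (ω * ((1 - x) * t) - Real.log 2 + αs * Real.log x +
        ω * b * ((1 - x) * t)) + κ * ε := by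
      rw [show κ * ε' = κ / a * (a * ε') by field_simp, hgain]
      field_simp
    -- The growth errors of all steps add up over disjoint time intervals; the term with `|1 + b|`
    -- is a budget proportional to the total time.
    have i1 : 0 ≤ (|1 + b| - (1 + b)) * (κ / a) * (ω * ((1 - x) * t)) := by
      have : 0 ≤ |1 + b| - (1 + b) := sub_nonneg.2 (le_abs_self _)
      have : 0 ≤ 1 - x := by linarith
      positivity
    have i2 : 0 ≤ ω * ((1 - x) * t) * ζ := by
      have : 0 ≤ 1 - x := by linarith
      positivity
    -- The shorter final time costs a factor `x ^ (-ν)` per step; the decay of the excess gains `x ^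
    -- (κ * αs / a)`, which more than compensates.
    have i3 : (κ / a * αs - ν) * Real.log x ≤ 0 := by
      refine mul_nonpos_of_nonneg_of_nonpos ?_ hlx0
      have e : αs = a * ν / (κ - 1) := by
        rw [eq_div_iff (by linarith)]; exact hαs
      have e' : κ / a * αs - ν = ν / (κ - 1) := by
        have : κ - 1 ≠ 0 := by linarith
        rw [e]
        field_simp
        ring
      rw [e']
      have : 0 < κ - 1 := by linarith
      positivity
    rw [hε'']
    push_cast
    linarith

/-- The `L^p`-`L^∞` estimate on `L^q ∩ L^∞`. -/
theorem ae_le_of_iterate {q p p' κ Δ ω ν ζ c c' a x b k αs : ℝ}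
    {T : ℝ≥0 → LqInf q μ → LqInf q μ} (hsg : IsSemigroup T)
    (hW : HasWeakEstimate T ω p p' κ ν ζ c) (hE : HasExcessEstimate T ω p Δ κ ν ζ c')
    (hω : 0 ≤ ω) (hκ : 1 < κ) (ha : 0 < a) (haΔ : a * Δ = κ - 1) (hν : 0 < ν) (hζ : 0 ≤ ζ)
    (hx0 : 0 < x) (hx1 : x < 1) (hαs : αs * (κ - 1) = a * ν)
    (hb : b * (κ - x) = (1 - x) * (a * ζ - κ))
    (hk : (κ - 1) * k =
      -αs * Real.log x + a * c' - αs * (κ - 1) * Real.log (1 - x) + κ * Real.log 2)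
    (t : ℝ≥0) (ht : 0 < t) (u v : LqInf q μ) (ε : ℝ)
    (he : excess μ 0 p ((u - v : LqInf q μ) : Ω →ₘ[μ] ℝ) ≤ ENNReal.ofReal (Real.exp ε)) :
    ∀ᵐ y ∂μ, |((T t u - T t v : LqInf q μ) : Ω →ₘ[μ] ℝ) y| ≤
      Real.exp (k - αs * Real.log t + ω * (b + 1) * t + a * ε) := by
  set Z := Real.exp (k - αs * Real.log t + ω * (b + 1) * t + a * ε) with hZ
  -- The weak bound blows up as `z → 0`, so the number of steps tends to infinity first, for fixed
  -- `z`.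
  have hnull : ∀ z : ℝ, 0 < z →
      μ {y | z + Z < |((T t u - T t v : LqInf q μ) : Ω →ₘ[μ] ℝ) y|} = 0 := by
    intro z hz
    have h1 : ∀ n : ℕ, μ {y | z + Z < |((T t u - T t v : LqInf q μ) : Ω →ₘ[μ] ℝ) y|} ≤
        ENNReal.ofReal (Real.exp (-(n * (κ / a * Real.log 2))) *
          (Real.exp (|1 + b| * (κ / a) * (ω * t) +
          (c - ν * Real.log t + ω * t * ζ) + κ * ε) * z ^ (-p'))) := by
      intro n
      have := meas_lt_le_of_iterate hsg hW hE hω hκ ha haΔ hν hζ hx0 hx1 hαs hb hk n t ht u v 0 ε z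
        le_rfl hz he
      rw [zero_add, ← Real.exp_add, show ω * t + (k - αs * Real.log t + ω * b * t + a * ε) =
        k - αs * Real.log t + ω * (b + 1) * t + a * ε by ring] at this
      refine this.trans (le_of_eq ?_)
      rw [← mul_assoc (Real.exp _) (Real.exp _), ← Real.exp_add]
      congr 3
      ring
    have h2 : Tendsto (fun n : ℕ => ENNReal.ofReal (Real.exp (-(n * (κ / a * Real.log 2))) *
          (Real.exp (|1 + b| * (κ / a) * (ω * t) +
          (c - ν * Real.log t + ω * t * ζ) + κ * ε) * z ^ (-p')))) atTop (𝓝 0) := by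
      rw [← ENNReal.ofReal_zero]
      apply ENNReal.tendsto_ofReal
      rw [← zero_mul (Real.exp (|1 + b| * (κ / a) * (ω * t) +
          (c - ν * Real.log t + ω * t * ζ) + κ * ε) * z ^ (-p'))]
      refine Tendsto.mul_const _ (Real.tendsto_exp_neg_atTop_nhds_zero.comp ?_)
      have : 0 < κ / a * Real.log 2 := by
        have := Real.log_pos one_lt_two
        positivity
      exact tendsto_natCast_atTop_atTop.atTop_mul_const this
    exact le_antisymm (ge_of_tendsto' h2 h1) zero_le
  have hall : ∀ᵐ y ∂μ, ∀ n : ℕ, ¬ (1 / ((n : ℝ) + 1) + Z <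
      |((T t u - T t v : LqInf q μ) : Ω →ₘ[μ] ℝ) y|) := by
    rw [ae_all_iff]
    intro n
    rw [ae_iff]
    simpa using hnull (1 / ((n : ℝ) + 1)) (by positivity)
  filter_upwards [hall] with y hy
  have hlim : Tendsto (fun n : ℕ => 1 / ((n : ℝ) + 1) + Z) atTop (𝓝 (0 + Z)) :=
    tendsto_one_div_add_atTop_nhds_zero_nat.add_const Z
  rw [zero_add] at hlim
  exact ge_of_tendsto' hlim fun n => not_lt.1 (hy n)

end Iteration

end NonlinearExtrapolation

namespace NonlinearExtrapolation

/-! ### Algebra of the exponents and choice of the step ratio. -/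

section Parameters

theorem le_target_exponent {q r γ m₀ : ℝ} (hq : 0 < q) (hγ : 0 < γ) (hγr : q < γ * r)
    (hm₀ : q * γ⁻¹ ≤ m₀) (hpos : 0 < denom q r γ m₀) : q ≤ γ * r / q * m₀ := by
  obtain ⟨κ, hκ⟩ : ∃ κ, κ = γ * r / q := ⟨_, rfl⟩
  have hr : r = κ * q / γ := by rw [hκ]; field_simp
  have hκ1 : 1 < κ := by rw [hκ, one_lt_div hq]; exact hγr
  rw [denom, ← hκ] at hpos
  rw [← hκ]
  have hm : q ≤ γ * m₀ := by
    rw [← div_eq_mul_inv, div_le_iff₀ hγ] at hm₀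
    linarith
  -- For `γ ≤ κ` the lower bound on `m₀` suffices; for `κ ≤ γ` the positivity of `δ` is used,
  -- through `γ (κ - 1) ≤ κ (γ - 1)`.
  rcases le_total γ κ with h | h
  · have h0 : 0 ≤ m₀ := le_of_mul_le_mul_left (by linarith) hγ
    nlinarith
  · have h1 : 0 < γ * ((κ - 1) * m₀ + q * (1 / γ - 1)) := by positivity
    have h2 : γ * ((κ - 1) * m₀ + q * (1 / γ - 1)) = γ * (κ - 1) * m₀ - q * (γ - 1) := by
      field_simp
      ring
    rw [h2] at h1
    have h3 : q * (γ - 1) * κ < γ * (κ - 1) * (κ * m₀) := by nlinarith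
    have h4 : γ * (κ - 1) * q ≤ q * (γ - 1) * κ := by nlinarith
    have h5 : 0 < γ * (κ - 1) := mul_pos hγ (by linarith)
    exact (lt_of_mul_lt_mul_left (h4.trans_lt h3) h5.le).le

theorem improvement_eq {q r γ m₀ κ : ℝ} (hq : 0 < q) (hγ : 0 < γ) (hκ : κ = γ * r / q) :
    r + κ * (κ * m₀ - q) - κ * m₀ = κ * denom q r γ m₀ := by
  have hr : r = κ * q / γ := by rw [hκ]; field_simp
  rw [denom, ← hκ, hr]
  field_simp
  ring

/-- The left side is `a * ζ - κ`, the driving term in the equation for `b`. Its sign is that of `N`,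
which decides whether the factor `(1 - x) / (κ - x)` should be made small or large. -/
theorem growth_identity {q r γ m₀ κ β : ℝ} (hq : 0 < q) (hγ : 0 < γ) (hκ : κ = γ * r / q)
    (hκ1 : 1 < κ) (hpos : 0 < denom q r γ m₀) :
    (κ - 1) / (κ * denom q r γ m₀) * (r * β + κ * (κ * m₀ - q)) - κ =
      q * betaNum q r β γ / (γ * denom q r γ m₀) := by
  have hr : r = κ * q / γ := by rw [hκ]; field_simp
  have hd : γ * denom q r γ m₀ = γ * (κ - 1) * m₀ + q * (1 - γ) := by
    rw [denom, ← hκ]; field_simp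
  have hκ0 : κ ≠ 0 := by positivity
  rw [betaNum, ← hκ]
  have hd0 := hpos.ne'
  rw [div_mul_eq_mul_div, sub_eq_iff_eq_add, div_eq_iff (by positivity)]
  set d := denom q r γ m₀
  have e : (q * ((β - 1) * κ + γ - β) / (γ * d) + κ) * (κ * d) =
      (q * ((β - 1) * κ + γ - β) * κ + κ ^ 2 * (γ * d)) / γ := by
    field_simp
  rw [e, hd, hr]
  field_simp
  ring

/-- The growth exponent produced by the time steps `(1 - x) xⁿ t`. -/
noncomputable def stepExponent (q r β γ m₀ x : ℝ) : ℝ :=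
  (1 - x) * (q * betaNum q r β γ) / ((γ * r / q - x) * (γ * denom q r γ m₀)) + 1

theorem stepExponent_half {q r β γ m₀ : ℝ} (hq : 0 < q) (hγ : 0 < γ) (hγr : q < γ * r)
    (hpos : 0 < denom q r γ m₀) : stepExponent q r β γ m₀ (1 / 2) = betaStar' q r β γ m₀ := by
  have hκ1 : 1 < γ * r / q := by rw [one_lt_div hq]; exact hγr
  rw [stepExponent, betaStar']
  generalize γ * r / q = κ at *
  have h1 : 2 * κ - 1 ≠ 0 := by linarith
  have h2 : κ - 1 / 2 ≠ 0 := by linarith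
  have h3 := hpos.ne'
  have h4 : κ - 1 / 2 = (2 * κ - 1) / 2 := by ring
  rw [h4]
  field_simp
  ring

theorem exists_step_of_nonneg {q r γ m₀ : ℝ} (hq : 0 < q) (hγ : 0 < γ) (hγr : q < γ * r)
    (hpos : 0 < denom q r γ m₀) :
    ∃ x : ℝ, 0 < x ∧ x < 1 ∧ ∀ β, 0 ≤ betaNum q r β γ →
      stepExponent q r β γ m₀ x ≤ betaStar q r β γ m₀ := by
  have hκ1 : 1 < γ * r / q := by rw [one_lt_div hq]; exact hγr
  have hden : 0 < q + γ * (γ * r / q - 1) := by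
    have : 0 < γ * r / q - 1 := by linarith
    positivity
  have hy : 0 < γ * (γ * r / q - 1) := mul_pos hγ (by linarith)
  -- For `N ≥ 0` it is enough that `(1 - x) q ≤ γ (κ - x)`. This `x` solves `(1 - x) q = x γ (κ -
  -- 1)`, and `x (κ - 1) ≤ κ - x`. It must not depend on `β`, since the constant depends on `x`.
  refine ⟨q / (q + γ * (γ * r / q - 1)), by positivity, ?_, fun β hN => ?_⟩
  · rw [div_lt_one hden]; linarith
  · rw [stepExponent, betaStar]
    set κ := γ * r / q
    set x := q / (q + γ * (κ - 1)) with hx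
    have hx1 : x < 1 := by rw [hx, div_lt_one hden]; linarith
    have hxe : (1 - x) * q = x * (γ * (κ - 1)) := by rw [hx]; field_simp; ring
    have hle : (1 - x) * q ≤ γ * (κ - x) := by
      rw [hxe]
      nlinarith
    have hκx : 0 < κ - x := by linarith
    gcongr ?_ + 1
    rw [div_le_div_iff₀ (by positivity) hpos]
    nlinarith [mul_nonneg (mul_nonneg (sub_nonneg.2 hle) hN) hpos.le]

theorem exists_step_of_neg {q r γ m₀ : ℝ} (hq : 0 < q) (hγ : 0 < γ) (hγr : q < γ * r)
    (hpos : 0 < denom q r γ m₀) :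
    ∃ x : ℝ, 0 < x ∧ x < 1 ∧ ∀ β, betaNum q r β γ < 0 → γ ^ 2 * r < q ^ 2 →
      stepExponent q r β γ m₀ x ≤ betaStar q r β γ m₀ := by
  by_cases h : γ ^ 2 * r < q ^ 2
  swap
  · exact ⟨1 / 2, by norm_num, by norm_num, fun β _ h' => absurd h' h⟩
  have hκ1 : 1 < γ * r / q := by rw [one_lt_div hq]; exact hγr
  have h' : γ * (γ * r / q) < q := by
    rw [← mul_div_assoc, div_lt_iff₀ hq]
    linarith
  have hγq : γ < q := by nlinarith
  have hden : 0 < q - γ := by linarith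
  have hx1 : (q - γ * (γ * r / q)) / (q - γ) < 1 := by
    rw [div_lt_one hden]
    nlinarith
  -- The solution of `(1 - x) q = γ (κ - x)`, which gives `betaStar` exactly; it is positive because
  -- `γ ^ 2 * r < q ^ 2` means `γ κ < q`.
  refine ⟨(q - γ * (γ * r / q)) / (q - γ), div_pos (by linarith) hden, hx1, fun β hN _ => ?_⟩
  rw [stepExponent, betaStar]
  set κ := γ * r / q
  set x := (q - γ * κ) / (q - γ) with hx
  have hxe : (1 - x) * q = γ * (κ - x) := by rw [hx]; field_simp; ring
  have hκx : 0 < κ - x := by linarith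
  gcongr ?_ + 1
  apply le_of_eq
  rw [← mul_assoc, hxe]
  field_simp

end Parameters

/-! ### Density, the estimate on `L^q ∩ L^∞`, and continuous extension. -/

section Extension

/-- A Hölder continuous map on a dense set extends continuously. -/
theorem exists_continuous_extension {P F : Type*} [NormedAddCommGroup P] [NormedAddCommGroup F]
    [CompleteSpace F] {s : Set P} (hs : Dense s) (ψ : s → F) {H θ : ℝ} (hθ : 0 < θ)
    (hψ : ∀ x y : s, ‖ψ x - ψ y‖ ≤ H * ‖(x : P) - y‖ ^ θ) :
    ∃ E : P → F, Continuous E ∧ ∀ x : s, E x = ψ x := by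
  have huc : UniformContinuous ψ := by
    rw [UniformContinuous, tendsto_uniformity_iff_dist_tendsto_zero]
    have h : Tendsto (fun p : s × s => H * ‖(p.1 : P) - p.2‖ ^ θ) (uniformity s) (𝓝 0) := by
      have h1 : Tendsto (fun p : s × s => dist (p.1 : P) p.2) (uniformity s) (𝓝 0) :=
        tendsto_uniformity_iff_dist_tendsto_zero.1 uniformContinuous_subtype_val
      have h2 := (h1.rpow_const (Or.inr hθ.le)).const_mul H
      rw [Real.zero_rpow hθ.ne', mul_zero] at h2
      simpa only [dist_eq_norm] using h2
    refine squeeze_zero (fun _ => dist_nonneg) (fun p => ?_) h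
    rw [dist_eq_norm]
    exact hψ _ _
  have hi : IsUniformInducing (Subtype.val : s → P) := isUniformInducing_val s
  have hd : DenseRange (Subtype.val : s → P) := hs.denseRange_val
  exact ⟨_, (uniformContinuous_uniformly_extend hi hd huc).continuous,
    uniformly_extend_of_ind hi hd huc⟩

variable {Ω : Type*} [MeasurableSpace Ω] {μ : Measure Ω}

/-- Interpolation: `|f| ^ p ≤ ‖f‖_∞ ^ (p - q) * |f| ^ q` almost everywhere. -/
theorem lqInf_le_lp {q p : ℝ} (hq : 0 < q) (hqp : q ≤ p) :
    LqInf q μ ≤ Lp ℝ (ENNReal.ofReal p) μ := by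
  intro f hf
  have hp : 0 < p := hq.trans_le hqp
  have h1 : eLpNorm f (ENNReal.ofReal q) μ < ∞ := Lp.mem_Lp_iff_eLpNorm_lt_top.1 hf.1
  have h2 : eLpNorm f ∞ μ < ∞ := Lp.mem_Lp_iff_eLpNorm_lt_top.1 hf.2
  rw [eLpNorm_exponent_top] at h2
  have h3 : excess μ 0 p f ≤ eLpNormEssSup f μ ^ (p - q) * excess μ 0 q f := by
    rw [excess, excess, ← lintegral_const_mul' _ _ (ENNReal.rpow_lt_top_of_nonneg
      (by linarith) h2.ne).ne]
    refine lintegral_mono_ae ?_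
    filter_upwards [enorm_ae_le_eLpNormEssSup (f : Ω → ℝ) μ] with x hx
    rw [sub_zero, ← Real.norm_eq_abs, ofReal_norm]
    calc ‖f x‖ₑ ^ p = ‖f x‖ₑ ^ (p - q) * ‖f x‖ₑ ^ q := by
          rw [← ENNReal.rpow_add_of_nonneg _ _ (by linarith) hq.le, sub_add_cancel]
      _ ≤ _ := by gcongr
  rw [Lp.mem_Lp_iff_eLpNorm_lt_top, eLpNorm_eq_excess hp]
  refine ENNReal.rpow_lt_top_of_nonneg (by positivity) (h3.trans_lt ?_).ne
  rw [excess_zero_eq hq]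
  exact ENNReal.mul_lt_top (ENNReal.rpow_lt_top_of_nonneg (by linarith) h2.ne)
    (ENNReal.rpow_lt_top_of_nonneg hq.le h1.ne)

/-- Simple functions are dense in `L^p`, and for them integrability does not depend on the finite
exponent. -/
theorem dense_lqInf {q p : ℝ} [Fact (1 ≤ ENNReal.ofReal p)] (hq : 0 < q) (hp : 0 < p) :
    Dense {f : Lp ℝ (ENNReal.ofReal p) μ | (f : Ω →ₘ[μ] ℝ) ∈ LqInf q μ} := by
  refine (Lp.simpleFunc.dense (E := ℝ) (μ := μ) (p := ENNReal.ofReal p)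
    ENNReal.ofReal_ne_top).mono ?_
  rintro f ⟨s, hs⟩
  have hmem : MemLp s (ENNReal.ofReal p) μ := by
    refine (memLp_congr_ae ?_).1 (Lp.memLp f)
    rw [← hs]
    exact AEEqFun.coeFn_mk _ _
  have hq' : MemLp s (ENNReal.ofReal q) μ := by
    rw [SimpleFunc.memLp_iff (by simpa using hq) ENNReal.ofReal_ne_top]
    exact (SimpleFunc.memLp_iff (by simpa using hp) ENNReal.ofReal_ne_top).1 hmem
  change (f : Ω →ₘ[μ] ℝ) ∈ LqInf q μ
  rw [← hs]
  exact ⟨(hq'.toLp s).2, ((s.memLp_top μ).toLp s).2⟩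

/-- The `L^p`-`L^∞` estimate for the maps of `T`, on `L^q ∩ L^∞`, for a given step ratio `x`. -/
theorem exists_lp_linf_bound {q r γ α M m₀ x : ℝ} (hq : 0 < q) (hr : 0 < r) (hα : 0 < α)
    (hγ : 0 < γ) (hM : 0 < M) (hγr : q < γ * r) (hm₀ : q * γ⁻¹ ≤ m₀)
    (hpos : 0 < denom q r γ m₀) (hx0 : 0 < x) (hx1 : x < 1) :
    ∃ K : ℝ, 0 < K ∧ ∀ (Ω : Type*) [MeasurableSpace Ω] (μ : Measure Ω) (ω β : ℝ)
      (T : ℝ≥0 → LqInf q μ → LqInf q μ), 0 ≤ ω → 0 < β → IsSemigroup T →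
      HasExpGrowthInf T ω → HasLqLrEstimate T r M α β γ ω →
      ∀ t : ℝ≥0, 0 < t → ∀ u v : LqInf q μ, u ≠ v →
        ∀ᵐ y ∂μ, |((T t u - T t v : LqInf q μ) : Ω →ₘ[μ] ℝ) y| ≤
          K * (t : ℝ) ^ (-alphaStar q r α γ m₀) * Real.exp (ω * stepExponent q r β γ m₀ x * t) *
          (eLpNorm ((u - v : LqInf q μ) : Ω →ₘ[μ] ℝ)
            (ENNReal.ofReal (γ * r / q * m₀)) μ).toReal ^ gammaStar q r γ m₀ := by
  obtain ⟨κ, hκ⟩ : ∃ κ, κ = γ * r / q := ⟨_, rfl⟩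
  have hκ1 : 1 < κ := by rw [hκ, one_lt_div hq]; exact hγr
  have hκ0 : 0 < κ := by linarith
  have hqp : q ≤ κ * m₀ := hκ ▸ le_target_exponent hq hγ hγr hm₀ hpos
  have hp : 0 < κ * m₀ := hq.trans_le hqp
  have himp := improvement_eq (m₀ := m₀) hq hγ hκ
  have hpp : κ * m₀ < r + κ * (κ * m₀ - q) := by
    have := mul_pos hκ0 hpos
    linarith
  set d := denom q r γ m₀ with hd
  set a := (κ - 1) / (κ * d) with ha
  have ha0 : 0 < a := div_pos (by linarith) (by positivity)
  set c' := Real.log (2 ^ (κ * m₀) * (1 - 2 ^ (-(r + κ * (κ * m₀ - q) - κ * m₀)))⁻¹) +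
        Real.log (2 ^ (r + κ * (κ * m₀ - q)) * M ^ r) with hc'
  set αs := alphaStar q r α γ m₀ with hαs
  -- Neither `ω` nor `β` enters `k`; they affect only the growth exponent. Hence the constant `e^k`
  -- is uniform.
  set k := (-αs * Real.log x + a * c' - αs * (κ - 1) * Real.log (1 - x) + κ * Real.log 2) /
    (κ - 1) with hk
  refine ⟨Real.exp k, Real.exp_pos _, ?_⟩
  intro Ω _ μ ω β T hω hβ hsg hT hT' t ht u v huv
  have ht' : (0 : ℝ) < t := ht
  have hW := hasWeakEstimate hq hr hM hqp hκ hκ0.le hT hT'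
  have hE := hasExcessEstimate hq hr hM hqp hκ hκ0.le hpp hT hT'
  have haΔ : a * (r + κ * (κ * m₀ - q) - κ * m₀) = κ - 1 := by
    rw [himp, ha]
    field_simp
  have hζ : 0 ≤ r * β + κ * (κ * m₀ - q) := by
    have : 0 ≤ κ * m₀ - q := by linarith
    positivity
  have hαsν : αs * (κ - 1) = a * (α * r) := by
    have hr' : r = κ * q / γ := by rw [hκ]; field_simp
    have e : αs = α * q * γ⁻¹ / d := rfl
    rw [e, ha]
    nth_rw 1 [hr']
    field_simp
  have hb : (stepExponent q r β γ m₀ x - 1) * (κ - x) =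
      (1 - x) * (a * (r * β + κ * (κ * m₀ - q)) - κ) := by
    rw [ha, hd, growth_identity hq hγ hκ hκ1 hpos, stepExponent, ← hκ]
    have : κ - x ≠ 0 := by linarith
    have := hpos.ne'
    rw [add_sub_cancel_right]
    field_simp
  have hk' : (κ - 1) * k =
      -αs * Real.log x + a * c' - αs * (κ - 1) * Real.log (1 - x) + κ * Real.log 2 := by
    rw [hk, mul_div_cancel₀ _ (by linarith)]
  have hmem : ((u - v : LqInf q μ) : Ω →ₘ[μ] ℝ) ∈ Lp ℝ (ENNReal.ofReal (κ * m₀)) μ :=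
    lqInf_le_lp hq hqp (u - v).2
  rw [← hκ]
  set n := (eLpNorm ((u - v : LqInf q μ) : Ω →ₘ[μ] ℝ) (ENNReal.ofReal (κ * m₀)) μ).toReal
    with hn
  have hfin := (Lp.mem_Lp_iff_eLpNorm_lt_top.1 hmem).ne
  -- Positivity of the norm lets the initial excess be written as `exp ε` with `ε = κ m₀ log n`.
  have hn0 : 0 < n := by
    refine ENNReal.toReal_pos (fun h0 => huv ?_) hfin
    rw [eLpNorm_eq_zero_iff (AEEqFun.aestronglyMeasurable _) (by simpa using hp)] at h0
    have h1 : ((u - v : LqInf q μ) : Ω →ₘ[μ] ℝ) = 0 :=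
      AEEqFun.ext (h0.trans AEEqFun.coeFn_zero.symm)
    exact sub_eq_zero.1 (Subtype.ext h1)
  have hex : excess μ 0 (κ * m₀) ((u - v : LqInf q μ) : Ω →ₘ[μ] ℝ) ≤
      ENNReal.ofReal (Real.exp (κ * m₀ * Real.log n)) := by
    rw [excess_zero_eq hp, ← ENNReal.ofReal_toReal hfin, ← hn, ENNReal.ofReal_rpow_of_pos hn0,
      Real.rpow_def_of_pos hn0, mul_comm]
  filter_upwards [ae_le_of_iterate hsg hW hE hω hκ1 ha0 haΔ (by positivity) hζ hx0 hx1 hαsν hb hk'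
    t ht u v _ hex] with y hy
  refine hy.trans (le_of_eq ?_)
  have hg : gammaStar q r γ m₀ = a * (κ * m₀) := by
    rw [gammaStar, ← hκ, ← hd, ha]
    field_simp
  rw [hg, Real.rpow_def_of_pos hn0, Real.rpow_def_of_pos ht', ← Real.exp_add, ← Real.exp_add,
    ← Real.exp_add]
  congr 1
  ring

end Extension

end NonlinearExtrapolation

namespace NonlinearExtrapolation

section Extension

theorem norm_sub_le_of_dense {P F : Type*} [NormedAddCommGroup P] [NormedAddCommGroup F]
    {s : Set P} (hs : Dense s) {E : P → F} (hE : Continuous E) {H θ : ℝ} (hθ : 0 ≤ θ)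
    (h : ∀ x ∈ s, ∀ y ∈ s, ‖E x - E y‖ ≤ H * ‖x - y‖ ^ θ) (x y : P) :
    ‖E x - E y‖ ≤ H * ‖x - y‖ ^ θ := by
  refine hs.denseRange_val.induction_on₂ (p := fun x y => ‖E x - E y‖ ≤ H * ‖x - y‖ ^ θ)
    ?_ (fun a b => h a a.2 b b.2) x y
  refine isClosed_le (by fun_prop) (continuous_const.mul ?_)
  exact (continuous_fst.sub continuous_snd).norm.rpow_const fun _ => Or.inr hθ

variable {Ω : Type*} [MeasurableSpace Ω] {μ : Measure Ω} {q p : ℝ}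

theorem isContinuousExtension_iff [Fact (1 ≤ ENNReal.ofReal p)] (hq : 0 < q) (hqp : q ≤ p)
    {S : LqInf q μ → LqInf q μ} {E : Lp ℝ (ENNReal.ofReal p) μ → Lp ℝ ∞ μ} :
    IsContinuousExtension S E ↔ Continuous E ∧
      ∀ u : LqInf q μ, E ⟨u, lqInf_le_lp hq hqp u.2⟩ = ⟨S u, (S u).2.2⟩ := by
  refine and_congr ?_ ⟨fun h u => ?_, fun h u => ⟨lqInf_le_lp hq hqp u.2, by rw [h u]⟩⟩
  · simp_rw [← tendsto_iff_norm_sub_tendsto_zero, continuous_iff_seqContinuous]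
    exact ⟨fun h w u hw => h u w hw, fun h u w hw => h hw⟩
  · obtain ⟨_, h2⟩ := h u
    exact Subtype.ext h2

/-- A family of Hölder estimates on `L^q ∩ L^∞` passes to the unique continuous extension. -/
theorem exists_unique_extension [Fact (1 ≤ ENNReal.ofReal p)] (hq : 0 < q) (hqp : q ≤ p)
    {S : LqInf q μ → LqInf q μ} {H θ : ℝ} (hθ : 0 < θ)
    (hS : ∀ u v : LqInf q μ, u ≠ v → ∀ᵐ y ∂μ, |((S u - S v : LqInf q μ) : Ω →ₘ[μ] ℝ) y| ≤
      H * (eLpNorm ((u - v : LqInf q μ) : Ω →ₘ[μ] ℝ) (ENNReal.ofReal p) μ).toReal ^ θ)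
    (hH : 0 ≤ H) :
    ∃ E : Lp ℝ (ENNReal.ofReal p) μ → Lp ℝ ∞ μ, IsContinuousExtension S E ∧
      (∀ E' : Lp ℝ (ENNReal.ofReal p) μ → Lp ℝ ∞ μ, IsContinuousExtension S E' → E' = E) ∧
      ∀ H' : ℝ, 0 ≤ H' → (∀ u v : LqInf q μ, u ≠ v →
        ∀ᵐ y ∂μ, |((S u - S v : LqInf q μ) : Ω →ₘ[μ] ℝ) y| ≤
        H' * (eLpNorm ((u - v : LqInf q μ) : Ω →ₘ[μ] ℝ) (ENNReal.ofReal p) μ).toReal ^ θ) →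
        ∀ u v, ‖E u - E v‖ ≤ H' * ‖u - v‖ ^ θ := by
  set s : Set (Lp ℝ (ENNReal.ofReal p) μ) := {f | (f : Ω →ₘ[μ] ℝ) ∈ LqInf q μ} with hs
  have hd : Dense s := dense_lqInf hq (hq.trans_le hqp)
  set ψ : s → Lp ℝ ∞ μ := fun f => ⟨S ⟨f.1, f.2⟩, (S ⟨f.1, f.2⟩).2.2⟩ with hψ
  have hbound : ∀ H' : ℝ, 0 ≤ H' → (∀ u v : LqInf q μ, u ≠ v →
        ∀ᵐ y ∂μ, |((S u - S v : LqInf q μ) : Ω →ₘ[μ] ℝ) y| ≤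
        H' * (eLpNorm ((u - v : LqInf q μ) : Ω →ₘ[μ] ℝ) (ENNReal.ofReal p) μ).toReal ^ θ) →
        ∀ x y : s, ‖ψ x - ψ y‖ ≤ H' * ‖(x : Lp ℝ (ENNReal.ofReal p) μ) - y‖ ^ θ := by
    intro H' hH' h x y
    rcases eq_or_ne x y with rfl | hxy
    · simp only [sub_self, norm_zero]
      positivity
    have h1 := h ⟨x.1, x.2⟩ ⟨y.1, y.2⟩ fun he => by
      have h0 : ((x : Lp ℝ (ENNReal.ofReal p) μ) : Ω →ₘ[μ] ℝ) = (y : Lp ℝ (ENNReal.ofReal p) μ) :=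
        congrArg (fun w : LqInf q μ => (w : Ω →ₘ[μ] ℝ)) he
      exact hxy (Subtype.ext (Subtype.ext h0))
    rw [Lp.norm_def]
    refine ENNReal.toReal_le_of_le_ofReal (by positivity) ?_
    rw [eLpNorm_exponent_top]
    exact eLpNormEssSup_le_of_ae_bound h1
  obtain ⟨E, hE, hEψ⟩ := exists_continuous_extension hd ψ hθ (hbound H hH hS)
  refine ⟨E, (isContinuousExtension_iff hq hqp).2 ⟨hE, fun u => hEψ ⟨⟨u, _⟩, u.2⟩⟩,
    fun E' hE' => ?_, fun H' hH' h => norm_sub_le_of_dense hd hE hθ.le fun x hx y hy => ?_⟩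
  · obtain ⟨hc, he⟩ := (isContinuousExtension_iff hq hqp).1 hE'
    refine hc.ext_on hd hE fun x hx => ?_
    rw [hEψ ⟨x, hx⟩]
    exact he ⟨x, hx⟩
  · rw [hEψ ⟨x, hx⟩, hEψ ⟨y, hy⟩]
    exact hbound H' hH' h ⟨x, hx⟩ ⟨y, hy⟩

end Extension

end NonlinearExtrapolation

theorem mainTheorem7 (q r C σ α γ m₀ : ℝ)
    (hq : 1 ≤ q) (hr : 1 ≤ r) (hC : 0 < C) (hσ : 0 < σ) (hα : 0 < α) (hγ : 0 < γ)
    (hγr : q < γ * r) (hm₀ : q * γ⁻¹ ≤ m₀)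
    (hpos : 0 < (γ * r / q - 1) * m₀ + q * (1 / γ - 1)) :
    ∃ K : ℝ, 0 < K ∧
      ∀ (Ω : Type*) [MeasurableSpace Ω] (μ : Measure Ω) [SigmaFinite μ] (ω β : ℝ)
        (T : ℝ≥0 → NonlinearExtrapolation.LqInf q μ → NonlinearExtrapolation.LqInf q μ),
        0 ≤ ω → 0 < β →
        NonlinearExtrapolation.IsSemigroup T →
        NonlinearExtrapolation.HasExpGrowthInf T ω →
        NonlinearExtrapolation.HasLqLrEstimate T r ((C / q) ^ (1 / σ)) α β γ ω →
        ∀ t : ℝ≥0, 0 < t →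
          ∃ E : Lp ℝ (ENNReal.ofReal (γ * r * q⁻¹ * m₀)) μ → Lp ℝ ∞ μ,
            NonlinearExtrapolation.IsContinuousExtension (T t) E ∧
            (∀ E' : Lp ℝ (ENNReal.ofReal (γ * r * q⁻¹ * m₀)) μ → Lp ℝ ∞ μ,
              NonlinearExtrapolation.IsContinuousExtension (T t) E' → E' = E) ∧
            (0 ≤ (β - 1) * (γ * r / q) + γ - β ∨ γ ^ 2 * r < q ^ 2 →
              ∀ u v : Lp ℝ (ENNReal.ofReal (γ * r * q⁻¹ * m₀)) μ,
                ‖E u - E v‖ ≤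
                  K * (t : ℝ) ^ (-NonlinearExtrapolation.alphaStar q r α γ m₀) *
                    Real.exp (ω * NonlinearExtrapolation.betaStar q r β γ m₀ * t) *
                    ‖u - v‖ ^ NonlinearExtrapolation.gammaStar q r γ m₀) ∧
            (∀ u v : Lp ℝ (ENNReal.ofReal (γ * r * q⁻¹ * m₀)) μ,
              ‖E u - E v‖ ≤
                K * (t : ℝ) ^ (-NonlinearExtrapolation.alphaStar q r α γ m₀) *
                  Real.exp (ω * NonlinearExtrapolation.betaStar' q r β γ m₀ * t) *
                  ‖u - v‖ ^ NonlinearExtrapolation.gammaStar q r γ m₀) := by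
  have hq0 : 0 < q := by linarith
  have hr0 : 0 < r := by linarith
  have hM : 0 < (C / q) ^ (1 / σ) := by positivity
  have hd : 0 < NonlinearExtrapolation.denom q r γ m₀ := hpos
  have hqp := NonlinearExtrapolation.le_target_exponent hq0 hγ hγr hm₀ hd
  obtain ⟨x₁, h10, h11, hx₁⟩ := NonlinearExtrapolation.exists_step_of_nonneg hq0 hγ hγr hd
  obtain ⟨x₂, h20, h21, hx₂⟩ := NonlinearExtrapolation.exists_step_of_neg hq0 hγ hγr hd
  obtain ⟨K₁, hK₁, hb₁⟩ :=
    NonlinearExtrapolation.exists_lp_linf_bound hq0 hr0 hα hγ hM hγr hm₀ hd h10 h11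
  obtain ⟨K₂, hK₂, hb₂⟩ :=
    NonlinearExtrapolation.exists_lp_linf_bound hq0 hr0 hα hγ hM hγr hm₀ hd h20 h21
  obtain ⟨K₃, hK₃, hb₃⟩ := NonlinearExtrapolation.exists_lp_linf_bound hq0 hr0 hα hγ hM hγr hm₀ hd
    (x := 1 / 2) (by norm_num) (by norm_num)
  -- One summand for each of the three step ratios, all fixed before `β` is known.
  refine ⟨K₁ + K₂ + K₃, by positivity, ?_⟩
  intro Ω _ μ _ ω β T hω hβ hsg hT hT' t ht
  have ht' : (0 : ℝ) < t := ht
  have c₁ := hb₁ Ω μ ω β T hω hβ hsg hT hT' t ht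
  have c₂ := hb₂ Ω μ ω β T hω hβ hsg hT hT' t ht
  have c₃ := hb₃ Ω μ ω β T hω hβ hsg hT hT' t ht
  rw [NonlinearExtrapolation.stepExponent_half hq0 hγ hγr hd] at c₃
  have hpe : γ * r / q * m₀ = γ * r * q⁻¹ * m₀ := by rw [div_eq_mul_inv]
  rw [hpe] at c₁ c₂ c₃ hqp
  have : Fact (1 ≤ ENNReal.ofReal (γ * r * q⁻¹ * m₀)) :=
    ⟨by rw [ENNReal.one_le_ofReal]; exact hq.trans hqp⟩
  have hm₀' : 0 < m₀ := lt_of_lt_of_le (by positivity) hm₀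
  have hκ1 : 1 < γ * r / q := by rw [one_lt_div hq0]; exact hγr
  have hθ : 0 < NonlinearExtrapolation.gammaStar q r γ m₀ :=
    div_pos (mul_pos (by linarith) hm₀') hd
  -- The estimate with `x = 1 / 2` holds without a case assumption, so it constructs `E`; `hEb` then
  -- transfers every other estimate to this same `E`.
  obtain ⟨E, hE, huniq, hEb⟩ :=
    NonlinearExtrapolation.exists_unique_extension hq0 hqp hθ c₃ (by positivity)
  refine ⟨E, hE, huniq, fun hcase => ?_, ?_⟩
  · refine hEb _ (by positivity) fun u v huv => ?_
    rcases le_or_gt 0 (NonlinearExtrapolation.betaNum q r β γ) with hN | hN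
    · filter_upwards [c₁ u v huv] with y hy
      refine hy.trans ?_
      gcongr
      · linarith
      · exact hx₁ β hN
    · have hlt : γ ^ 2 * r < q ^ 2 := hcase.resolve_left (not_le.2 hN)
      filter_upwards [c₂ u v huv] with y hy
      refine hy.trans ?_
      gcongr
      · linarith
      · exact hx₂ β hN hlt
  · refine hEb _ (by positivity) fun u v huv => ?_
    filter_upwards [c₃ u v huv] with y hy
    refine hy.trans ?_
    gcongr
    linarith
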